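/- Let $m\ge 1$ be an odd integer. Then the following series, understood as the limit of its partial sums, converges, and $$\sum_{n=1}^{\infty}(-1)^{n+1}H_n\sum_{j=0}^{m-1}\frac{(-1)^j}{2mn+2j+1}=\frac{(m+1)\pi}{4}\log 2-mG+\frac{\pi}{2}\sum_{k=0}^{\frac{m-3}{2}}\log\left(1+\sqrt{\frac{1-\varphi_k}{2}}\right),$$ where $H_n=\sum_{i=1}^{n}\frac1i$ is the $n$-th harmonic number, $G=\sum_{n=0}^{\infty}\frac{(-1)^n}{(2n+1)^2}$ is Catalan's constant, $\varphi_k=\cos\left(\frac{(2k+1)\pi}{m}\right)$, and for $m=1$ the sum over $k$ is empty, hence $0$. -/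

import Mathlib

open Filter Topology

/-- Catalan's constant `G = ∑_{n ≥ 0} (-1)^n / (2n+1)^2` (an absolutely convergent series). -/
noncomputable def catalanConstant : ℝ :=
  ∑' n : ℕ, (-1 : ℝ) ^ n / (2 * (n : ℝ) + 1) ^ 2

/-- `φ_k = cos ((2k+1) π / m)`. -/
noncomputable def varphi (m k : ℕ) : ℝ :=
  Real.cos ((2 * (k : ℝ) + 1) * Real.pi / (m : ℝ))

/-- The `n`-th term
`(-1)^(n+1) * H_n * ∑_{j=0}^{m-1} (-1)^j / (2mn + 2j + 1)`
of the Euler-BBP-type series, `H_n = 1 + 1/2 + ⋯ + 1/n` being the harmonic number. -/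
noncomputable def eulerBBPTerm (m n : ℕ) : ℝ :=
  (-1 : ℝ) ^ (n + 1) * ((harmonic n : ℚ) : ℝ) *
    ∑ j ∈ Finset.range m, (-1 : ℝ) ^ j / (2 * (m : ℝ) * (n : ℝ) + 2 * (j : ℝ) + 1)

/-! Since `m` is odd, the inner sum over `j` is the integral over [0,1] of x^(2mn) (1 + x^(2m)) / (1
+ x^2). With y = x^(2m), summation by parts turns (1 + y) ∑ (-1)^(n+1) H_n y^n into a Taylor
polynomial of log(1 + y) plus a boundary term that vanishes in the mean, so the series equals ∫
log(1 + x^(2m)) / (1 + x^2) over [0,1] (`tendsto_sum_eulerBBPTerm`).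

Over the reals, 1 + x^(2m) is 1 + x^2 times the quartics x^4 - 2 φ_k x^2 + 1 = (1 - x^2)^2 + 4 s^2
x^2, where s = √((1 - φ_k)/2) (`one_add_pow_eq_prod_varphi`). Under x = tan t such a quartic becomes
(cos² 2t + s² sin² 2t) / cos⁴ t. Jensen's formula integrates the logarithm of the numerator, and ∫
log cos over [0, π/4] brings in G (`integral_log_quartic_div_one_add_sq`). The factor 1 + x^2 is the
square root of the case s = 1. -/

/-! ### Reduction of the series to a logarithmic integral -/

theorem one_add_mul_sum_harmonic (y : ℝ) (N : ℕ) :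
    (1 + y) * ∑ n ∈ Finset.Icc 1 N, (-1 : ℝ) ^ (n + 1) * ((harmonic n : ℚ) : ℝ) * y ^ n =
      ∑ n ∈ Finset.Icc 1 N, (-1 : ℝ) ^ (n + 1) * y ^ n / n +
        (-1 : ℝ) ^ (N + 1) * ((harmonic N : ℚ) : ℝ) * y ^ (N + 1) := by
  induction N with
  | zero => simp
  | succ N ih =>
    rw [Finset.sum_Icc_succ_top (by omega), Finset.sum_Icc_succ_top (by omega), mul_add, ih,
      harmonic_succ]
    push_cast
    field_simp
    ring

theorem hasDerivAt_log_one_add_sub_sum {y : ℝ} (hy : 0 ≤ y) (N : ℕ) :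
    HasDerivAt
      (fun y : ℝ => Real.log (1 + y) - ∑ n ∈ Finset.Icc 1 N, (-1 : ℝ) ^ (n + 1) * y ^ n / n)
      ((-1) ^ N * y ^ N / (1 + y)) y := by
  have h1 : 1 + y ≠ 0 := by positivity
  induction N with
  | zero => simpa using ((hasDerivAt_id y).const_add 1).log h1
  | succ N ih =>
    have h2 : HasDerivAt (fun y : ℝ => (-1 : ℝ) ^ (N + 1 + 1) * y ^ (N + 1) / ((N + 1 : ℕ) : ℝ))
        ((-1 : ℝ) ^ (N + 1 + 1) * y ^ N) y := by
      refine (((hasDerivAt_pow (N + 1) y).const_mul ((-1 : ℝ) ^ (N + 1 + 1))).div_const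
        ((N + 1 : ℕ) : ℝ)).congr_deriv ?_
      push_cast
      field_simp
    have h3 := (ih.sub h2).congr_deriv
      (g' := (-1) ^ (N + 1) * y ^ (N + 1) / (1 + y)) (by field_simp; ring)
    refine h3.congr_of_eventuallyEq (Eventually.of_forall fun z => ?_)
    simp only [Pi.sub_apply]
    rw [Finset.sum_Icc_succ_top (by omega)]
    ring

/-- Both sides vanish at 0, and the derivative (-1)^N y^N / (1 + y) of the remainder is at most y^N
in absolute value. -/
theorem abs_log_one_add_sub_sum_le {y : ℝ} (hy : 0 ≤ y) (N : ℕ) :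
    |Real.log (1 + y) - ∑ n ∈ Finset.Icc 1 N, (-1 : ℝ) ^ (n + 1) * y ^ n / n| ≤
      y ^ (N + 1) / (N + 1) := by
  have hd (z : ℝ) : HasDerivAt (fun y : ℝ => y ^ (N + 1) / ((N : ℝ) + 1)) (z ^ N) z := by
    refine ((hasDerivAt_pow (N + 1) z).div_const ((N : ℝ) + 1)).congr_deriv ?_
    push_cast
    field_simp
  refine image_norm_le_of_norm_deriv_right_le_deriv_boundary
    (f := fun y : ℝ => Real.log (1 + y) - ∑ n ∈ Finset.Icc 1 N, (-1 : ℝ) ^ (n + 1) * y ^ n / n)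
    (a := 0) (b := y)
    (fun z hz => (hasDerivAt_log_one_add_sub_sum hz.1 N).continuousAt.continuousWithinAt)
    (fun z hz => (hasDerivAt_log_one_add_sub_sum hz.1 N).hasDerivWithinAt) ?_ hd ?_
    (Set.right_mem_Icc.2 hy)
  · rw [Finset.sum_eq_zero]
    · simp
    · intro n hn
      have : n ≠ 0 := by have := (Finset.mem_Icc.1 hn).1; omega
      simp [this]
  · intro z hz
    have hz0 : 0 ≤ z := hz.1
    rw [Real.norm_eq_abs, abs_div, abs_mul, abs_pow, abs_neg, abs_one, one_pow, one_mul,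
      abs_of_nonneg (pow_nonneg hz0 N), abs_of_pos (by positivity : 0 < 1 + z)]
    exact div_le_self (by positivity) (by linarith)

theorem intervalIntegrable_div_one_add_sq {f : ℝ → ℝ} (hf : Continuous f) (a b : ℝ) :
    IntervalIntegrable (fun x => f x / (1 + x ^ 2)) MeasureTheory.volume a b :=
  (hf.div (by fun_prop) (fun x => by positivity)).intervalIntegrable a b

/-- For odd `m` the geometric sum of ratio -x^2 and length `m` is (1 + x^(2m)) / (1 + x^2). -/
theorem integral_pow_mul_div_one_add_sq {m : ℕ} (hm : Odd m) (n : ℕ) :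
    ∫ x in (0 : ℝ)..1, x ^ (2 * m * n) * (1 + x ^ (2 * m)) / (1 + x ^ 2) =
      ∑ j ∈ Finset.range m, (-1 : ℝ) ^ j / (2 * (m : ℝ) * (n : ℝ) + 2 * (j : ℝ) + 1) := by
  have h (x : ℝ) : x ^ (2 * m * n) * (1 + x ^ (2 * m)) / (1 + x ^ 2) =
      ∑ j ∈ Finset.range m, (-1 : ℝ) ^ j * x ^ (2 * m * n + 2 * j) := by
    have hg := geom_sum_mul_neg (-x ^ 2) m
    rw [div_eq_iff (by positivity)]
    rw [hm.neg_pow, ← pow_mul] at hg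
    have : ∑ j ∈ Finset.range m, (-1 : ℝ) ^ j * x ^ (2 * m * n + 2 * j) =
        x ^ (2 * m * n) * ∑ j ∈ Finset.range m, (-x ^ 2) ^ j := by
      rw [Finset.mul_sum]
      refine Finset.sum_congr rfl fun j _ => ?_
      rw [neg_pow (x ^ 2), pow_add, ← pow_mul]
      ring
    rw [this]
    linear_combination (-x ^ (2 * m * n)) * hg
  simp_rw [h]
  rw [intervalIntegral.integral_finsetSum fun j _ =>
    (by fun_prop : Continuous fun x : ℝ => (-1 : ℝ) ^ j * x ^ (2 * m * n + 2 * j)).intervalIntegrable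
      0 1]
  refine Finset.sum_congr rfl fun j _ => ?_
  rw [intervalIntegral.integral_const_mul, integral_pow]
  simp [div_eq_mul_inv]

theorem sum_eulerBBPTerm_eq_integral {m : ℕ} (hm : Odd m) (N : ℕ) :
    ∑ n ∈ Finset.Icc 1 N, eulerBBPTerm m n =
      ∫ x in (0 : ℝ)..1,
        (∑ n ∈ Finset.Icc 1 N, (-1 : ℝ) ^ (n + 1) * (x ^ (2 * m)) ^ n / n +
          (-1 : ℝ) ^ (N + 1) * ((harmonic N : ℚ) : ℝ) * (x ^ (2 * m)) ^ (N + 1)) / (1 + x ^ 2) := by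
  simp_rw [← one_add_mul_sum_harmonic, eulerBBPTerm, ← integral_pow_mul_div_one_add_sq hm,
    ← intervalIntegral.integral_const_mul]
  rw [← intervalIntegral.integral_finsetSum fun n _ =>
    (intervalIntegrable_div_one_add_sq (by fun_prop) 0 1).const_mul _]
  refine intervalIntegral.integral_congr fun x _ => ?_
  simp only [Finset.mul_sum, Finset.sum_div]
  refine Finset.sum_congr rfl fun n _ => ?_
  rw [← pow_mul]
  ring

theorem abs_integral_sub_sum_eulerBBPTerm_le {m : ℕ} (hm : Odd m) (N : ℕ) :
    |(∫ x in (0 : ℝ)..1, Real.log (1 + x ^ (2 * m)) / (1 + x ^ 2)) -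
      ∑ n ∈ Finset.Icc 1 N, eulerBBPTerm m n| ≤ (1 + ((harmonic N : ℚ) : ℝ)) / (N + 1) := by
  have hm0 := hm.pos
  have hpos (x : ℝ) : 0 < 1 + x ^ (2 * m) := by rw [pow_mul]; positivity
  have hH : (0 : ℝ) ≤ ((harmonic N : ℚ) : ℝ) := by
    rw [harmonic]; push_cast; positivity
  have hlog : Continuous fun x : ℝ => Real.log (1 + x ^ (2 * m)) :=
    Continuous.log (by fun_prop) fun x => (hpos x).ne'
  rw [sum_eulerBBPTerm_eq_integral hm, ← intervalIntegral.integral_sub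
    (intervalIntegrable_div_one_add_sq hlog 0 1)
    (intervalIntegrable_div_one_add_sq (by fun_prop) 0 1)]
  have hb : ∀ x ∈ Set.Ioc (0 : ℝ) 1, ‖Real.log (1 + x ^ (2 * m)) / (1 + x ^ 2) -
      (∑ n ∈ Finset.Icc 1 N, (-1 : ℝ) ^ (n + 1) * (x ^ (2 * m)) ^ n / n +
        (-1 : ℝ) ^ (N + 1) * ((harmonic N : ℚ) : ℝ) * (x ^ (2 * m)) ^ (N + 1)) / (1 + x ^ 2)‖ ≤
      (1 + ((harmonic N : ℚ) : ℝ)) * x ^ N := by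
    intro x hx
    have hx0 : 0 ≤ x := hx.1.le
    -- A crude bound suffices: the integral of x^N is 1/(N+1), which still beats the logarithmic
    -- growth of H_N.
    have hy : (x ^ (2 * m)) ^ (N + 1) ≤ x ^ N := by
      rw [← pow_mul]
      exact pow_le_pow_of_le_one hx0 hx.2 (by nlinarith)
    have hy0 : 0 ≤ (x ^ (2 * m)) ^ (N + 1) := by positivity
    rw [← sub_div, Real.norm_eq_abs, abs_div, abs_of_pos (by positivity : 0 < 1 + x ^ 2),
      ← sub_sub]
    refine (div_le_self (abs_nonneg _) (by nlinarith)).trans ((abs_sub _ _).trans ?_)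
    have h1 := abs_log_one_add_sub_sum_le (y := x ^ (2 * m)) (by positivity) N
    have h2 : (x ^ (2 * m)) ^ (N + 1) / ((N : ℝ) + 1) ≤ (x ^ (2 * m)) ^ (N + 1) :=
      div_le_self hy0 (by linarith [(Nat.cast_nonneg N : (0 : ℝ) ≤ N)])
    rw [abs_mul, abs_mul, abs_pow, abs_neg, abs_one, one_pow, one_mul, abs_of_nonneg hH,
      abs_of_nonneg hy0]
    nlinarith [mul_le_mul_of_nonneg_left hy hH]
  refine (intervalIntegral.norm_integral_le_of_norm_le zero_le_one
    (Filter.Eventually.of_forall hb)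
    ((by fun_prop : Continuous fun x : ℝ =>
      (1 + ((harmonic N : ℚ) : ℝ)) * x ^ N).intervalIntegrable 0 1)).trans ?_
  rw [intervalIntegral.integral_const_mul, integral_pow]
  simp [div_eq_mul_inv]

theorem tendsto_one_add_harmonic_div :
    Tendsto (fun N : ℕ => (1 + ((harmonic N : ℚ) : ℝ)) / (N + 1)) atTop (𝓝 0) := by
  have h1 : Tendsto (fun N : ℕ => Real.log (N : ℝ) / (N : ℝ)) atTop (𝓝 0) :=
    (Real.isLittleO_log_id_atTop.tendsto_div_nhds_zero).comp tendsto_natCast_atTop_atTop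
  have h2 : Tendsto (fun N : ℕ => (2 : ℝ) / N + Real.log (N : ℝ) / N) atTop (𝓝 0) := by
    simpa using (tendsto_const_div_atTop_nhds_zero_nat (2 : ℝ)).add h1
  refine tendsto_of_tendsto_of_tendsto_of_le_of_le' tendsto_const_nhds h2
    (Eventually.of_forall fun N => ?_) ?_
  · have : (0 : ℝ) ≤ ((harmonic N : ℚ) : ℝ) := by rw [harmonic]; push_cast; positivity
    positivity
  · filter_upwards [eventually_gt_atTop 0] with N hN
    have hN' : (0 : ℝ) < N := by exact_mod_cast hN
    have h := harmonic_le_one_add_log N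
    have hl : 0 ≤ Real.log (N : ℝ) := Real.log_natCast_nonneg N
    rw [← add_div]
    exact div_le_div₀ (by linarith) (by linarith) hN' (by linarith)

theorem tendsto_sum_eulerBBPTerm {m : ℕ} (hm : Odd m) :
    Tendsto (fun N : ℕ => ∑ n ∈ Finset.Icc 1 N, eulerBBPTerm m n) atTop
      (𝓝 (∫ x in (0 : ℝ)..1, Real.log (1 + x ^ (2 * m)) / (1 + x ^ 2))) := by
  rw [tendsto_iff_dist_tendsto_zero]
  refine squeeze_zero (fun _ => dist_nonneg) (fun N => ?_) tendsto_one_add_harmonic_div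
  rw [dist_comm]
  exact abs_integral_sub_sum_eulerBBPTerm_le hm N

/-! ### Real factorization of 1 + y^m -/

theorem prod_range_two_mul_add_one {M : Type*} [CommMonoid M] (f : ℕ → M) (p : ℕ) :
    ∏ i ∈ Finset.range (2 * p + 1), f i =
      f p * ∏ k ∈ Finset.range p, f k * f (2 * p - k) := by
  rw [show 2 * p + 1 = p + 1 + p by ring, Finset.prod_range_add, Finset.prod_range_succ,
    Finset.prod_mul_distrib, ← Finset.prod_range_reflect (fun i => f (p + 1 + i))]
  rw [mul_comm (∏ k ∈ Finset.range p, f k), mul_assoc]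
  congr 2
  refine Finset.prod_congr rfl fun k hk => ?_
  have := Finset.mem_range.1 hk
  rw [show p + 1 + (p - 1 - k) = 2 * p - k by omega]

-- The roots of y^m = -1 are the odd powers of ξ = exp(πi/m). The middle one, ξ^m = -1, gives 1 + y;
-- the others pair off into conjugates, k with 2p - k, with sum 2 φ_k and product 1.
open Complex in
theorem one_add_pow_eq_prod_varphi (p : ℕ) (y : ℝ) :
    1 + y ^ (2 * p + 1) =
      (1 + y) * ∏ k ∈ Finset.range p, (y ^ 2 - 2 * varphi (2 * p + 1) k * y + 1) := by
  have hm : (2 * (p : ℂ) + 1) ≠ 0 := by exact_mod_cast (by omega : 2 * p + 1 ≠ 0)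
  have hprim := Complex.isPrimitiveRoot_exp (2 * p + 1) (by omega)
  set ζ : ℂ := exp (2 * Real.pi * I / ((2 * p + 1 : ℕ) : ℂ)) with hζ
  set ξ : ℂ := exp (Real.pi * I / ((2 * p + 1 : ℕ) : ℂ)) with hξ
  have hξζ : ξ ^ 2 = ζ := by rw [hξ, hζ, ← exp_nat_mul]; congr 1; push_cast; ring
  have hξm : ξ ^ (2 * p + 1) = -1 := by
    rw [hξ, ← exp_nat_mul, mul_div_cancel₀ _ (by exact_mod_cast (by omega : 2 * p + 1 ≠ 0)),
      exp_pi_mul_I]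
  have hprod : ((1 + y ^ (2 * p + 1) : ℝ) : ℂ) =
      ∏ k ∈ Finset.range (2 * p + 1), ((y : ℂ) - ξ ^ (2 * k + 1)) := by
    have h := hprim.pow_sub_pow_eq_prod_sub_mul (y : ℂ) ξ (by omega)
    rw [hξm] at h
    push_cast
    rw [show (1 : ℂ) + (y : ℂ) ^ (2 * p + 1) = (y : ℂ) ^ (2 * p + 1) - -1 by ring, h]
    symm
    refine Finset.prod_bij (fun k _ => ζ ^ k) ?_ ?_ ?_ ?_
    · intro k _
      rw [Polynomial.mem_nthRootsFinset (by omega), ← pow_mul, mul_comm, pow_mul, hprim.pow_eq_one,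
        one_pow]
    · intro i hi j hj hij
      exact hprim.pow_inj (Finset.mem_range.1 hi) (Finset.mem_range.1 hj) hij
    · intro b hb
      rw [Polynomial.mem_nthRootsFinset (by omega)] at hb
      obtain ⟨i, hi, rfl⟩ := hprim.eq_pow_of_pow_eq_one hb
      exact ⟨i, Finset.mem_range.2 hi, rfl⟩
    · intro k _
      rw [pow_succ, pow_mul, hξζ]
  have hpair (k : ℕ) (hk : k < p) :
      ((y : ℂ) - ξ ^ (2 * k + 1)) * ((y : ℂ) - ξ ^ (2 * (2 * p - k) + 1)) =
        (y : ℂ) ^ 2 - 2 * (varphi (2 * p + 1) k : ℂ) * y + 1 := by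
    have h1 : ξ ^ (2 * k + 1) * ξ ^ (2 * (2 * p - k) + 1) = 1 := by
      rw [← pow_add, show 2 * k + 1 + (2 * (2 * p - k) + 1) = (2 * p + 1) * 2 by omega, pow_mul,
        hξm]
      norm_num
    have h2 : ξ ^ (2 * k + 1) + ξ ^ (2 * (2 * p - k) + 1) = 2 * (varphi (2 * p + 1) k : ℂ) := by
      rw [eq_inv_of_mul_eq_one_right h1, varphi, ofReal_cos, two_cos, hξ, ← exp_nat_mul,
        ← exp_neg]
      congr 2
      · push_cast; ring
      · push_cast; ring
    linear_combination h1 - (y : ℂ) * h2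
  apply Complex.ofReal_injective
  rw [hprod, prod_range_two_mul_add_one, hξm, Finset.prod_congr rfl fun k hk =>
    hpair k (Finset.mem_range.1 hk)]
  push_cast
  ring

theorem varphi_eq_one_sub_two_mul_sq (m k : ℕ) :
    varphi m k = 1 - 2 * Real.sqrt ((1 - varphi m k) / 2) ^ 2 := by
  have h : varphi m k ≤ 1 := Real.cos_le_one _
  rw [Real.sq_sqrt (by linarith)]
  ring

theorem sqrt_one_sub_varphi_pos {p k : ℕ} (hk : k < p) :
    0 < Real.sqrt ((1 - varphi (2 * p + 1) k) / 2) := by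
  have hk' : (k : ℝ) + 1 ≤ p := by exact_mod_cast hk
  have hk0 : (0 : ℝ) ≤ k := Nat.cast_nonneg k
  apply Real.sqrt_pos.2
  have hp := Real.pi_pos
  have : varphi (2 * p + 1) k < 1 := by
    rw [varphi]
    push_cast
    refine (Real.cos_lt_cos_of_nonneg_of_le_pi (x := 0) le_rfl ?_ (by positivity)).trans_eq
      Real.cos_zero
    rw [div_le_iff₀ (by positivity), mul_comm]
    exact mul_le_mul_of_nonneg_left (by linarith) hp.le
  linarith

/-! ### Integrals giving Catalan's constant -/

theorem intervalIntegrable_pow_mul_log (n : ℕ) (a b : ℝ) :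
    IntervalIntegrable (fun x : ℝ => x ^ n * Real.log x) MeasureTheory.volume a b :=
  intervalIntegral.intervalIntegrable_log'.continuousOn_mul (by fun_prop)

theorem integral_pow_mul_log (n : ℕ) :
    ∫ x in (0 : ℝ)..1, x ^ n * Real.log x = -1 / ((n : ℝ) + 1) ^ 2 := by
  have hn : (n : ℝ) + 1 ≠ 0 := by positivity
  -- Grouping x log x keeps the antiderivative continuous at 0.
  have hc : Continuous fun x : ℝ =>
      x ^ n * (x * Real.log x) / (n + 1) - x ^ (n + 1) / ((n : ℝ) + 1) ^ 2 := by
    have := Real.continuous_mul_log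
    fun_prop
  rw [intervalIntegral.integral_eq_sub_of_hasDerivAt_of_le zero_le_one hc.continuousOn
    (fun x hx => ?_) (intervalIntegrable_pow_mul_log n 0 1)]
  · simp [neg_div]
  · have hx0 : x ≠ 0 := hx.1.ne'
    have h := (((hasDerivAt_pow (n + 1) x).mul (Real.hasDerivAt_log hx0)).div_const
      ((n : ℝ) + 1)).sub ((hasDerivAt_pow (n + 1) x).div_const (((n : ℝ) + 1) ^ 2))
    refine (h.congr_deriv ?_).congr_of_eventuallyEq (Eventually.of_forall fun z => ?_)
    · push_cast
      field_simp
      ring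
    · simp only [Pi.sub_apply, Pi.mul_apply]
      ring

theorem intervalIntegrable_log_div_one_add_sq (a b : ℝ) :
    IntervalIntegrable (fun x : ℝ => Real.log x / (1 + x ^ 2)) MeasureTheory.volume a b := by
  simp_rw [div_eq_mul_inv]
  exact intervalIntegral.intervalIntegrable_log'.mul_continuousOn
    (Continuous.inv₀ (by fun_prop) fun x => by positivity).continuousOn

/-- Expanding 1/(1 + x^2) geometrically leaves a remainder of size at most -x^(2N) log x, whose
integral is 1/(2N+1)^2. -/
theorem abs_integral_log_div_add_sum_le (N : ℕ) :
    |(∫ x in (0 : ℝ)..1, Real.log x / (1 + x ^ 2)) +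
      ∑ n ∈ Finset.range N, (-1 : ℝ) ^ n / (2 * (n : ℝ) + 1) ^ 2| ≤ 1 / ((N : ℝ) + 1) := by
  have hsum : ∑ n ∈ Finset.range N, (-1 : ℝ) ^ n / (2 * (n : ℝ) + 1) ^ 2 =
      -∫ x in (0 : ℝ)..1, ∑ n ∈ Finset.range N, (-1 : ℝ) ^ n * (x ^ (2 * n) * Real.log x) := by
    rw [intervalIntegral.integral_finsetSum fun n _ =>
      (intervalIntegrable_pow_mul_log (2 * n) 0 1).const_mul _, ← Finset.sum_neg_distrib]
    refine Finset.sum_congr rfl fun n _ => ?_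
    rw [intervalIntegral.integral_const_mul, integral_pow_mul_log]
    push_cast
    ring
  have hint : IntervalIntegrable (fun x : ℝ => ∑ n ∈ Finset.range N,
      (-1 : ℝ) ^ n * (x ^ (2 * n) * Real.log x)) MeasureTheory.volume 0 1 := by
    have h := IntervalIntegrable.sum (Finset.range N) fun n _ =>
      (intervalIntegrable_pow_mul_log (2 * n) 0 1).const_mul ((-1 : ℝ) ^ n)
    simpa only [Finset.sum_fn] using h
  rw [hsum, ← sub_eq_add_neg,
    ← intervalIntegral.integral_sub (intervalIntegrable_log_div_one_add_sq 0 1) hint]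
  have hb : ∀ x ∈ Set.Ioc (0 : ℝ) 1, ‖Real.log x / (1 + x ^ 2) -
      ∑ n ∈ Finset.range N, (-1 : ℝ) ^ n * (x ^ (2 * n) * Real.log x)‖ ≤
      -(x ^ (2 * N) * Real.log x) := by
    intro x hx
    have hx0 : 0 < x := hx.1
    have hl : Real.log x ≤ 0 := Real.log_nonpos hx0.le hx.2
    have hg := geom_sum_mul_neg (-x ^ 2) N
    have he : ∑ n ∈ Finset.range N, (-1 : ℝ) ^ n * (x ^ (2 * n) * Real.log x) =
        (∑ n ∈ Finset.range N, (-x ^ 2) ^ n) * Real.log x := by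
      rw [Finset.sum_mul]
      refine Finset.sum_congr rfl fun n _ => ?_
      rw [neg_pow (x ^ 2), ← pow_mul]
      ring
    have he2 : Real.log x / (1 + x ^ 2) -
        ∑ n ∈ Finset.range N, (-1 : ℝ) ^ n * (x ^ (2 * n) * Real.log x) =
        (-1) ^ N * (x ^ (2 * N) * Real.log x) / (1 + x ^ 2) := by
      rw [neg_pow, ← pow_mul] at hg
      rw [he, eq_div_iff (by positivity), sub_mul, div_mul_cancel₀ _ (by positivity)]
      linear_combination (-Real.log x) * hg
    rw [he2, Real.norm_eq_abs, abs_div, abs_of_pos (by positivity : 0 < 1 + x ^ 2), abs_mul,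
      abs_pow, abs_neg, abs_one, one_pow, one_mul,
      abs_of_nonpos (mul_nonpos_of_nonneg_of_nonpos (by positivity) hl)]
    refine div_le_self ?_ (by nlinarith)
    have : 0 < x ^ (2 * N) := by positivity
    nlinarith
  refine (intervalIntegral.norm_integral_le_of_norm_le zero_le_one
    (Filter.Eventually.of_forall hb) (intervalIntegrable_pow_mul_log (2 * N) 0 1).neg).trans ?_
  rw [intervalIntegral.integral_neg, integral_pow_mul_log, neg_div, neg_neg]
  have hN : (0 : ℝ) ≤ N := Nat.cast_nonneg N
  push_cast
  exact one_div_le_one_div_of_le (by positivity) (by nlinarith)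

theorem summable_catalanConstant :
    Summable fun n : ℕ => (-1 : ℝ) ^ n / (2 * (n : ℝ) + 1) ^ 2 := by
  have h : Summable fun n : ℕ => 1 / ((n : ℝ) + 1) ^ 2 := by
    have := (summable_nat_add_iff 1).2 (Real.summable_one_div_nat_pow.2 one_lt_two)
    simpa using this
  refine Summable.of_norm_bounded h fun n => ?_
  rw [Real.norm_eq_abs, abs_div, abs_pow, abs_neg, abs_one, one_pow, abs_of_nonneg (by positivity)]
  have hn : (0 : ℝ) ≤ n := Nat.cast_nonneg n
  gcongr
  linarith

theorem integral_log_div_one_add_sq :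
    ∫ x in (0 : ℝ)..1, Real.log x / (1 + x ^ 2) = -catalanConstant := by
  have h1 := (summable_catalanConstant.hasSum.tendsto_sum_nat).const_add
    (∫ x in (0 : ℝ)..1, Real.log x / (1 + x ^ 2))
  have h2 := squeeze_zero_norm (fun N => (Real.norm_eq_abs _).trans_le (abs_integral_log_div_add_sum_le N))
    tendsto_one_div_add_atTop_nhds_zero_nat
  exact eq_neg_of_add_eq_zero_left (tendsto_nhds_unique h1 h2)

theorem integral_log_sin_sub_log_cos :
    ∫ t in (0 : ℝ)..(Real.pi / 4), (Real.log (Real.sin t) - Real.log (Real.cos t)) =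
      -catalanConstant := by
  have hpi := Real.pi_pos
  rw [← integral_log_div_one_add_sq]
  have himg : Real.arctan '' (Set.uIcc 0 1) ⊆ Set.uIcc 0 (Real.pi / 4) := by
    rintro _ ⟨x, hx, rfl⟩
    rw [Set.uIcc_of_le zero_le_one] at hx
    rw [Set.uIcc_of_le (by positivity), ← Real.arctan_one, ← Real.arctan_zero]
    exact ⟨Real.arctan_mono hx.1, Real.arctan_mono hx.2⟩
  have hg : IntervalIntegrable (fun t => Real.log (Real.sin t) - Real.log (Real.cos t))
      MeasureTheory.volume 0 (Real.pi / 4) :=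
    (intervalIntegrable_log_sin (a := 0) (b := Real.pi / 4)).sub intervalIntegrable_log_cos
  have hcomp (x : ℝ) (hx : 0 ≤ x) : ((fun t => Real.log (Real.sin t) - Real.log (Real.cos t)) ∘
      Real.arctan) x * (1 / (1 + x ^ 2)) = Real.log x / (1 + x ^ 2) := by
    -- At x = 0 both sides are 0 by the convention `Real.log 0 = 0`.
    rcases hx.eq_or_lt with rfl | hx
    · simp
    · have hs : Real.sin (Real.arctan x) ≠ 0 := by
        rw [Real.sin_arctan]; positivity
      simp only [Function.comp_apply]
      rw [← Real.log_div hs (Real.cos_arctan_pos x).ne', ← Real.tan_eq_sin_div_cos,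
        Real.tan_arctan]
      ring
  -- The integrand is singular at t = 0, so this form of substitution is used: continuity in the
  -- interior and integrability are enough.
  have h := intervalIntegral.integral_comp_mul_deriv''' (a := 0) (b := 1) (f := Real.arctan)
    (f' := fun x => 1 / (1 + x ^ 2))
    (g := fun t => Real.log (Real.sin t) - Real.log (Real.cos t))
    Real.continuous_arctan.continuousOn
    (fun x _ => (Real.hasDerivAt_arctan x).hasDerivWithinAt) ?_ ?_ ?_
  · rw [Real.arctan_zero, Real.arctan_one] at h
    rw [← h]
    refine intervalIntegral.integral_congr fun x hx => ?_
    rw [Set.uIcc_of_le zero_le_one] at hx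
    exact hcomp x hx.1
  · rintro _ ⟨x, hx, rfl⟩
    have hx0 : 0 < x := by simpa using hx.1
    have hs : Real.sin (Real.arctan x) ≠ 0 := by
      rw [Real.sin_arctan]; positivity
    exact ((Real.continuous_sin.continuousAt.log hs).sub
      (Real.continuous_cos.continuousAt.log (Real.cos_arctan_pos x).ne')).continuousWithinAt
  · exact ((intervalIntegrable_iff' (by simp)).1 hg).mono_set himg
  · refine ((intervalIntegrable_iff' (by simp)).1 (intervalIntegrable_log_div_one_add_sq 0 1)).congr_fun
      (fun x hx => ?_) measurableSet_uIcc
    rw [Set.uIcc_of_le zero_le_one] at hx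
    exact (hcomp x hx.1).symm

/-- The integrals of log sin and log cos over [0, π/4] differ by -G, and by reflection they add up
to ∫ log sin over [0, π/2], which is -(π/2) log 2. -/
theorem integral_log_cos_zero_pi_div_four :
    ∫ t in (0 : ℝ)..(Real.pi / 4), Real.log (Real.cos t) =
      catalanConstant / 2 - Real.pi / 4 * Real.log 2 := by
  have hs (a b : ℝ) : IntervalIntegrable (fun t => Real.log (Real.sin t)) MeasureTheory.volume a b :=
    intervalIntegrable_log_sin
  have hc (a b : ℝ) : IntervalIntegrable (fun t => Real.log (Real.cos t)) MeasureTheory.volume a b :=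
    intervalIntegrable_log_cos
  have h1 := integral_log_sin_sub_log_cos
  rw [intervalIntegral.integral_sub (hs _ _) (hc _ _)] at h1
  have h2 := integral_log_sin_zero_pi_div_two
  rw [← intervalIntegral.integral_add_adjacent_intervals (hs 0 (Real.pi / 4))
    (hs (Real.pi / 4) (Real.pi / 2))] at h2
  have h3 : ∫ t in (Real.pi / 4)..(Real.pi / 2), Real.log (Real.sin t) =
      ∫ t in (0 : ℝ)..(Real.pi / 4), Real.log (Real.cos t) := by
    have := intervalIntegral.integral_comp_sub_left (fun t => Real.log (Real.sin t)) (Real.pi / 2)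
      (a := 0) (b := Real.pi / 4)
    simp only [Real.sin_pi_div_two_sub] at this
    rw [this]
    congr 1 <;> ring
  rw [h3] at h2
  linarith

/-! ### Jensen's formula and the quartic integrals -/

theorem norm_circleMap_add_ofReal_sq (r θ : ℝ) :
    ‖circleMap 0 1 θ + (r : ℂ)‖ ^ 2 = 1 + r ^ 2 + 2 * r * Real.cos θ := by
  rw [← Complex.normSq_eq_norm_sq, circleMap, Complex.normSq_apply]
  simp [Complex.exp_ofReal_mul_I_re, Complex.exp_ofReal_mul_I_im]
  nlinarith [Real.sin_sq_add_cos_sq θ]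

/-- The integrand is 2 log |e^(iθ) + r|, whose circle average is 2 log⁺ |r| = 0. -/
theorem integral_log_one_add_sq_add_cos {r : ℝ} (hr : |r| < 1) :
    ∫ θ in (0 : ℝ)..(2 * Real.pi), Real.log (1 + r ^ 2 + 2 * r * Real.cos θ) = 0 := by
  have h := circleAverage_log_norm_add_const_eq_posLog (a := (r : ℂ))
  rw [Real.posLog_eq_zero_iff _ |>.2 (by simpa using hr.le), Real.circleAverage_def] at h
  simp_rw [← norm_circleMap_add_ofReal_sq, Real.log_pow, intervalIntegral.integral_const_mul]
  have hpi : (2 * Real.pi)⁻¹ ≠ 0 := by positivity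
  rw [(smul_eq_zero.1 h).resolve_left hpi, mul_zero]

theorem integral_log_cos_sq_add_sin_sq {s : ℝ} (hs : 0 < s) :
    ∫ t in (0 : ℝ)..(Real.pi / 4),
        Real.log (Real.cos (2 * t) ^ 2 + s ^ 2 * Real.sin (2 * t) ^ 2) =
      Real.pi / 2 * Real.log ((1 + s) / 2) := by
  -- This `r` makes cos² 2t + s² sin² 2t equal to ((1 + s)/2)² (1 + r² + 2 r cos 4t).
  set r : ℝ := (1 - s) / (1 + s) with hr
  have hs1 : 1 + s ≠ 0 := by positivity
  have hr1 : |r| < 1 := by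
    rw [hr, abs_div, abs_of_pos (by positivity : 0 < 1 + s), div_lt_one (by positivity), abs_lt]
    constructor <;> linarith
  have hrpos (θ : ℝ) : 0 < 1 + r ^ 2 + 2 * r * Real.cos θ := by
    have h1 := abs_lt.1 hr1
    nlinarith [Real.sin_sq_add_cos_sq θ, sq_nonneg (r + Real.cos θ), sq_nonneg (Real.sin θ),
      sq_nonneg (1 + r * Real.cos θ), sq_nonneg r, Real.neg_one_le_cos θ, Real.cos_le_one θ,
      mul_pos (by linarith [h1.1] : 0 < 1 + r) (by linarith [h1.2] : 0 < 1 - r)]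
  have hfac (t : ℝ) : Real.log (Real.cos (2 * t) ^ 2 + s ^ 2 * Real.sin (2 * t) ^ 2) =
      2 * Real.log ((1 + s) / 2) + Real.log (1 + r ^ 2 + 2 * r * Real.cos (4 * t)) := by
    have h2 : (2 : ℝ) * Real.log ((1 + s) / 2) = Real.log (((1 + s) / 2) ^ 2) := by
      rw [Real.log_pow]; norm_num
    rw [h2, ← Real.log_mul (by positivity) (hrpos _).ne',
      show 4 * t = 2 * (2 * t) by ring, Real.cos_two_mul (2 * t), Real.sin_sq, hr]
    congr 1
    field_simp
    ring
  have hcont : Continuous fun θ : ℝ => Real.log (1 + r ^ 2 + 2 * r * Real.cos θ) :=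
    Continuous.log (by fun_prop) fun θ => (hrpos θ).ne'
  -- As t runs over [0, π/4], 4t covers only half the circle; the symmetry θ ↦ 2π - θ makes that
  -- half vanish too.
  have hzero : ∫ θ in (0 : ℝ)..Real.pi, Real.log (1 + r ^ 2 + 2 * r * Real.cos θ) = 0 := by
    have h := integral_log_one_add_sq_add_cos hr1
    rw [← intervalIntegral.integral_add_adjacent_intervals (hcont.intervalIntegrable 0 Real.pi)
      (hcont.intervalIntegrable Real.pi (2 * Real.pi))] at h
    have h' := intervalIntegral.integral_comp_sub_left
      (fun θ => Real.log (1 + r ^ 2 + 2 * r * Real.cos θ)) (2 * Real.pi) (a := 0) (b := Real.pi)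
    simp only [Real.cos_two_pi_sub] at h'
    rw [show 2 * Real.pi - Real.pi = Real.pi by ring, sub_zero] at h'
    linarith
  simp_rw [hfac]
  have hcont4 : Continuous fun t : ℝ => Real.log (1 + r ^ 2 + 2 * r * Real.cos (4 * t)) :=
    hcont.comp (continuous_const_mul 4)
  rw [intervalIntegral.integral_add (by simp) (hcont4.intervalIntegrable _ _),
    intervalIntegral.integral_comp_mul_left
      (fun θ => Real.log (1 + r ^ 2 + 2 * r * Real.cos θ)) (by norm_num : (4 : ℝ) ≠ 0),
    mul_zero, show 4 * (Real.pi / 4) = Real.pi by ring, hzero]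
  simp
  ring

theorem quartic_pos {s : ℝ} (hs : 0 < s) (x : ℝ) :
    0 < (1 - x ^ 2) ^ 2 + 4 * s ^ 2 * x ^ 2 := by
  rcases eq_or_ne x 0 with rfl | hx
  · norm_num
  · positivity

theorem integral_log_quartic_div_one_add_sq {s : ℝ} (hs : 0 < s) :
    ∫ x in (0 : ℝ)..1, Real.log ((1 - x ^ 2) ^ 2 + 4 * s ^ 2 * x ^ 2) / (1 + x ^ 2) =
      Real.pi / 2 * Real.log 2 + Real.pi / 2 * Real.log (1 + s) - 2 * catalanConstant := by
  have hpos (t : ℝ) : 0 < Real.cos (2 * t) ^ 2 + s ^ 2 * Real.sin (2 * t) ^ 2 := by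
    rcases eq_or_ne (Real.sin (2 * t)) 0 with h | h
    · have := Real.sin_sq_add_cos_sq (2 * t)
      rw [h] at this ⊢
      nlinarith
    · positivity
  have hcont : Continuous fun t : ℝ =>
      Real.log (Real.cos (2 * t) ^ 2 + s ^ 2 * Real.sin (2 * t) ^ 2) :=
    Continuous.log (by fun_prop) fun t => (hpos t).ne'
  have hcomp (x : ℝ) : ((fun t => Real.log (Real.cos (2 * t) ^ 2 + s ^ 2 * Real.sin (2 * t) ^ 2) -
      4 * Real.log (Real.cos t)) ∘ Real.arctan) x * (1 / (1 + x ^ 2)) =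
      Real.log ((1 - x ^ 2) ^ 2 + 4 * s ^ 2 * x ^ 2) / (1 + x ^ 2) := by
    have hc := Real.cos_arctan_pos x
    have hx : 1 + x ^ 2 ≠ 0 := by positivity
    have h4 : 4 * Real.log (Real.cos (Real.arctan x)) =
        Real.log (Real.cos (Real.arctan x) ^ 4) := by rw [Real.log_pow]; norm_num
    simp only [Function.comp_apply]
    rw [h4, ← Real.log_div (hpos _).ne' (by positivity), mul_one_div]
    congr 2
    have hsin : Real.sin (Real.arctan x) = x * Real.cos (Real.arctan x) := by
      rw [Real.sin_arctan, Real.cos_arctan]; ring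
    have hcos : Real.cos (Real.arctan x) ^ 2 * (1 + x ^ 2) = 1 := by
      rw [Real.cos_sq_arctan, one_div_mul_cancel hx]
    rw [div_eq_iff (by positivity), Real.cos_two_mul', Real.sin_two_mul, hsin]
    ring
  have h := intervalIntegral.integral_comp_mul_deriv' (a := 0) (b := 1) (f := Real.arctan)
    (f' := fun x => 1 / (1 + x ^ 2))
    (g := fun t => Real.log (Real.cos (2 * t) ^ 2 + s ^ 2 * Real.sin (2 * t) ^ 2) -
      4 * Real.log (Real.cos t))
    (fun x _ => Real.hasDerivAt_arctan x)
    (Continuous.div (by fun_prop) (by fun_prop) fun x => by positivity).continuousOn ?_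
  · simp_rw [hcomp] at h
    have hlc : IntervalIntegrable (fun t => Real.log (Real.cos t)) MeasureTheory.volume 0
      (Real.pi / 4) := intervalIntegrable_log_cos
    rw [h, Real.arctan_zero, Real.arctan_one,
      intervalIntegral.integral_sub (hcont.intervalIntegrable _ _) (hlc.const_mul 4),
      intervalIntegral.integral_const_mul, integral_log_cos_sq_add_sin_sq hs,
      integral_log_cos_zero_pi_div_four, Real.log_div (by positivity) (by norm_num)]
    ring
  · rintro _ ⟨x, _, rfl⟩
    exact (hcont.continuousAt.sub (continuousAt_const.mul
      (Real.continuous_cos.continuousAt.log (Real.cos_arctan_pos x).ne'))).continuousWithinAt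

/-! ### Assembly of the closed form -/

theorem integral_log_one_add_sq_div_one_add_sq :
    ∫ x in (0 : ℝ)..1, Real.log (1 + x ^ 2) / (1 + x ^ 2) =
      Real.pi / 2 * Real.log 2 - catalanConstant := by
  have h := integral_log_quartic_div_one_add_sq one_pos
  have he (x : ℝ) : Real.log ((1 - x ^ 2) ^ 2 + 4 * 1 ^ 2 * x ^ 2) / (1 + x ^ 2) =
      2 * (Real.log (1 + x ^ 2) / (1 + x ^ 2)) := by
    rw [show (1 - x ^ 2) ^ 2 + 4 * 1 ^ 2 * x ^ 2 = (1 + x ^ 2) ^ 2 by ring, Real.log_pow]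
    push_cast
    ring
  simp_rw [he] at h
  rw [intervalIntegral.integral_const_mul, one_add_one_eq_two] at h
  linarith

theorem integral_log_one_add_pow_div_one_add_sq (p : ℕ) :
    ∫ x in (0 : ℝ)..1, Real.log (1 + x ^ (2 * (2 * p + 1))) / (1 + x ^ 2) =
      ((p : ℝ) + 1) * Real.pi / 2 * Real.log 2 - (2 * (p : ℝ) + 1) * catalanConstant +
        Real.pi / 2 * ∑ k ∈ Finset.range p,
          Real.log (1 + Real.sqrt ((1 - varphi (2 * p + 1) k) / 2)) := by
  set s : ℕ → ℝ := fun k => Real.sqrt ((1 - varphi (2 * p + 1) k) / 2) with hs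
  have hspos (k : ℕ) (hk : k ∈ Finset.range p) : 0 < s k :=
    sqrt_one_sub_varphi_pos (Finset.mem_range.1 hk)
  have hlog (x : ℝ) : Real.log (1 + x ^ (2 * (2 * p + 1))) / (1 + x ^ 2) =
      Real.log (1 + x ^ 2) / (1 + x ^ 2) + ∑ k ∈ Finset.range p,
        Real.log ((1 - x ^ 2) ^ 2 + 4 * s k ^ 2 * x ^ 2) / (1 + x ^ 2) := by
    rw [← Finset.sum_div, ← add_div, ← Real.log_prod fun k hk => (quartic_pos (hspos k hk) x).ne',
      ← Real.log_mul (by positivity)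
        (Finset.prod_pos fun k hk => quartic_pos (hspos k hk) x).ne',
      pow_mul, one_add_pow_eq_prod_varphi]
    congr 3
    -- Writing φ_k = 1 - 2 s_k² completes the square in x^4 - 2 φ_k x^2 + 1.
    refine Finset.prod_congr rfl fun k _ => ?_
    rw [varphi_eq_one_sub_two_mul_sq]
    ring
  have hint (k : ℕ) (hk : k ∈ Finset.range p) : IntervalIntegrable (fun x : ℝ =>
      Real.log ((1 - x ^ 2) ^ 2 + 4 * s k ^ 2 * x ^ 2) / (1 + x ^ 2)) MeasureTheory.volume 0 1 :=
    intervalIntegrable_div_one_add_sq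
      (Continuous.log (by fun_prop) fun x => (quartic_pos (hspos k hk) x).ne') 0 1
  have hint0 : IntervalIntegrable (fun x : ℝ => Real.log (1 + x ^ 2) / (1 + x ^ 2))
      MeasureTheory.volume 0 1 :=
    intervalIntegrable_div_one_add_sq
      (Continuous.log (by fun_prop) fun x => by positivity) 0 1
  have hintS : IntervalIntegrable (fun x : ℝ => ∑ k ∈ Finset.range p,
      Real.log ((1 - x ^ 2) ^ 2 + 4 * s k ^ 2 * x ^ 2) / (1 + x ^ 2)) MeasureTheory.volume 0 1 := by
    simpa only [Finset.sum_fn] using IntervalIntegrable.sum (Finset.range p) hint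
  simp_rw [hlog]
  rw [intervalIntegral.integral_add hint0 hintS, intervalIntegral.integral_finsetSum hint,
    integral_log_one_add_sq_div_one_add_sq,
    Finset.sum_congr rfl fun k hk => integral_log_quartic_div_one_add_sq (hspos k hk),
    Finset.sum_sub_distrib, Finset.sum_add_distrib]
  simp only [Finset.sum_const, Finset.card_range, nsmul_eq_mul, ← Finset.mul_sum, hs]
  ring

/-- For odd `m ≥ 1` the series `∑_{n ≥ 1}` converges (as the limit of its partial sums; it is only
conditionally convergent) to the stated value. The index `k` runs over `0 ≤ k ≤ (m-3)/2`, that is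
`k < (m-1)/2`, and the sum is empty for `m = 1`. -/
theorem theorem3p1 (m : ℕ) (hm : Odd m) :
    Tendsto (fun N : ℕ => ∑ n ∈ Finset.Icc 1 N, eulerBBPTerm m n) atTop
      (𝓝 (((m : ℝ) + 1) * Real.pi / 4 * Real.log 2 - (m : ℝ) * catalanConstant
        + Real.pi / 2 * ∑ k ∈ Finset.range ((m - 1) / 2),
            Real.log (1 + Real.sqrt ((1 - varphi m k) / 2)))) := by
  have h := tendsto_sum_eulerBBPTerm hm
  obtain ⟨p, rfl⟩ := hm
  rw [integral_log_one_add_pow_div_one_add_sq] at h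
  rw [show (2 * p + 1 - 1) / 2 = p by omega]
  convert h using 2
  push_cast
  ring
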